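/- Let $R$ be a finite-dimensional (associative, unital) algebra over a field with infinite dominant dimension, i.e. in a minimal injective coresolution $0\to R\to E^0\to E^1\to\cdots$ of the left $R$-module $R$ all the modules $E^i$ ($i\ge 0$) are projective. By $R$-modules we mean left $R$-modules; $R^{op}$-modules are right $R$-modules. An acyclic ($\mathbb{Z}$-indexed) complex $X$ of projective modules is called totally acyclic if $\operatorname{Hom}(X,M)$ is acyclic for every projective module $M$; an acyclic complex $X$ of injective modules is called totally acyclic if $\operatorname{Hom}(M,X)$ is acyclic for every injective module $M$ (modules and homomorphisms over $R$, respectively over $R^{op}$; modules are not assumed finitely generated). Then the following are equivalent: 1. $R$ is self-injective, i.e. $R$ is injective as a left $R$-module. 2. All acyclic complexes of injective $R$-modules and all acyclic complexes of injective $R^{op}$-modules are totally acyclic. 3. All acyclic complexes of projective $R$-modules and all acyclic complexes of projective $R^{op}$-modules are totally acyclic. 4. All acyclic complexes of injective $R$-modules are totally acyclic. 5. All acyclic complexes of projective $R$-modules are totally acyclic. 6. All acyclic complexes of injective $R^{op}$-modules are totally acyclic. 7. All acyclic complexes of projective $R^{op}$-modules are totally acyclic. -/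

import Mathlib

open CategoryTheory

universe u

/-- A submodule `N` of `M` is essential if it meets every nonzero submodule of `M` nontrivially. -/
def IsEssentialSubmodule {R : Type u} [Ring R] {M : Type u} [AddCommGroup M] [Module R M]
    (N : Submodule R M) : Prop :=
  ∀ S : Submodule R M, N ⊓ S = ⊥ → S = ⊥

/-- An injective coresolution `0 ⟶ Z ⟶ E⁰ ⟶ E¹ ⟶ ⋯` is minimal if the image of `Z` is essential
in `E⁰` and the image of `Eⁿ` is essential in `Eⁿ⁺¹` for all `n`, i.e. if `E⁰` is an injective
envelope of `Z` and each `Eⁿ⁺¹` is an injective envelope of the image of `Eⁿ ⟶ Eⁿ⁺¹`. -/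
def IsMinimalInjectiveResolution {R : Type u} [Ring R] {Z : ModuleCat.{u} R}
    (E : InjectiveResolution Z) : Prop :=
  IsEssentialSubmodule (LinearMap.range (E.ι.f 0).hom) ∧
    ∀ n : ℕ, IsEssentialSubmodule (LinearMap.range (E.cocomplex.d n (n + 1)).hom)

/-- `R` has infinite dominant dimension: all the terms of a minimal injective coresolution of the
left module `R` are projective. (A minimal injective coresolution is unique up to isomorphism.) -/
def HasInfiniteDominantDimension (R : Type u) [Ring R] : Prop :=
  ∃ E : InjectiveResolution (ModuleCat.of R R),
    IsMinimalInjectiveResolution E ∧ ∀ n : ℕ, Module.Projective R (E.cocomplex.X n)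

/-- `R` is self-injective: it is injective as a left module over itself. -/
def IsSelfInjective (R : Type u) [Ring R] : Prop :=
  Module.Injective R R

/-- The complex of abelian groups `Hom_R(M, X)`. -/
noncomputable def homToComplex {R : Type u} [Ring R] (M : ModuleCat.{u} R)
    (X : ChainComplex (ModuleCat.{u} R) ℤ) :
    HomologicalComplex AddCommGrpCat.{u} (ComplexShape.down ℤ) :=
  ((preadditiveCoyoneda.obj (Opposite.op M)).mapHomologicalComplex (ComplexShape.down ℤ)).obj X

/-- The complex of abelian groups `Hom_R(X, M)`. -/
noncomputable def homFromComplex {R : Type u} [Ring R]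
    (X : ChainComplex (ModuleCat.{u} R) ℤ) (M : ModuleCat.{u} R) :
    HomologicalComplex AddCommGrpCat.{u} (ComplexShape.down ℤ).symm :=
  ((preadditiveYoneda.obj M).mapHomologicalComplex (ComplexShape.down ℤ).symm).obj X.op

/-- A totally acyclic complex of projective modules. -/
structure IsTotallyAcyclicOfProjectives {R : Type u} [Ring R]
    (X : ChainComplex (ModuleCat.{u} R) ℤ) : Prop where
  projective : ∀ n : ℤ, Module.Projective R (X.X n)
  acyclic : X.Acyclic
  hom_acyclic : ∀ M : ModuleCat.{u} R, Module.Projective R M → (homFromComplex X M).Acyclic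

/-- A totally acyclic complex of injective modules. -/
structure IsTotallyAcyclicOfInjectives {R : Type u} [Ring R]
    (X : ChainComplex (ModuleCat.{u} R) ℤ) : Prop where
  injective : ∀ n : ℤ, Module.Injective R (X.X n)
  acyclic : X.Acyclic
  hom_acyclic : ∀ M : ModuleCat.{u} R, Module.Injective R M → (homToComplex M X).Acyclic

/-- Every acyclic complex of projective left `R`-modules is totally acyclic. -/
def AcyclicProjectivesTotallyAcyclic (R : Type u) [Ring R] : Prop :=
  ∀ X : ChainComplex (ModuleCat.{u} R) ℤ,
    (∀ n : ℤ, Module.Projective R (X.X n)) → X.Acyclic → IsTotallyAcyclicOfProjectives X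

/-- Every acyclic complex of injective left `R`-modules is totally acyclic. -/
def AcyclicInjectivesTotallyAcyclic (R : Type u) [Ring R] : Prop :=
  ∀ X : ChainComplex (ModuleCat.{u} R) ℤ,
    (∀ n : ℤ, Module.Injective R (X.X n)) → X.Acyclic → IsTotallyAcyclicOfInjectives X

/-!
Write `D = Hom_k(-, k)` for the duality between left and right modules over the finite-dimensional
algebra `R`. Infinite dominant dimension gives a coresolution `0 → R → E⁰ → E¹ → ⋯` by projective
modules that are also injective, and minimality makes them finitely generated
(`HasInfiniteDominantDimension.hasProjInjCoresolution`).

*From total acyclicity to self-injectivity.* The coresolution is an acyclic complex of projective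
left modules. If it stays exact under `Hom(-, R)`, then `R → E⁰` splits and `R` is injective
(`HasProjInjCoresolution.injective`). Its dual `⋯ → D E¹ → D E⁰ → D R → 0` is an acyclic complex of
injective right modules. If it stays exact under `Hom(D R, -)`, then `D R` is projective
(`HasProjInjResolution.projective`), and again `R` is injective. For the conditions on the other
side one needs two symmetries.

*Infinite dominant dimension is symmetric* (`HasProjInjCoresolution.opposite`). Resolve the
injective cogenerator `I = D R`, now taken as a left module, by successive right approximations by
finitely generated projective-injective modules, giving a complex `Y` of injective modules that
remains exact under `Hom(E, -)` for every such `E`. If `0 → Z → E → C → 0` is a step of the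
coresolution of `R`, then `0 → Hom(C, Y) → Hom(E, Y) → Hom(Z, Y) → 0` is exact with acyclic middle
term, so the homology of `Hom(Z, Y)` is that of `Hom(C, Y)` one degree lower. As `Y` is bounded
below, all of it vanishes, and `Z = R` shows that `Y` is exact. Its dual is a coresolution of the
right module `R`. The dimension shift is `LiftsAlongApproximations.ker`.

*Self-injectivity is symmetric* (`IsSelfInjective.opposite`). If `R` is left self-injective, every
simple right module is isomorphic to `yR` for some `y` with `Ry` simple, and `Ry` determines `yR`
up to isomorphism. Hence `S ↦ Ry`, with `y` chosen for the simple right module `D S`, is an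
injection of the finite set of isomorphism classes of simple left modules into itself, so every
simple left module embeds into `R`. Then `R` is an injective cogenerator, the left module `D R` is
a direct summand of a projective module, and so the right module `R` is injective.

*From self-injectivity to total acyclicity.* Over a self-injective finite-dimensional algebra a
module, finitely generated or not, is projective if and only if it is injective
(`injective_of_projective_of_isSelfInjective`, `projective_of_injective_of_isSelfInjective`), and
`Hom` into an injective or out of a projective module preserves exactness.

Left and right modules are treated alike by working with two algebras `A` and `B` and an isomorphism
`τ` of `A` with the opposite of `B`.
-/

/-! ### The vector space duality between modules over opposite algebras -/

noncomputable section Duality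

open MulOpposite

variable {k A B : Type u} [Field k] [Ring A] [Ring B] [Algebra k A] [Algebra k B]

/-- The anti-isomorphism `B → A` underlying an isomorphism of `A` with the opposite of `B`. -/
def antiIso (τ : A ≃ₐ[k] Bᵐᵒᵖ) (b : B) : A := τ.symm (op b)

/-- The same identification, read as an isomorphism of `B` with the opposite of `A`. -/
def revIso (τ : A ≃ₐ[k] Bᵐᵒᵖ) : B ≃ₐ[k] Aᵐᵒᵖ := (AlgEquiv.opComm τ).symm

@[simp] lemma antiIso_revIso_antiIso (τ : A ≃ₐ[k] Bᵐᵒᵖ) (b : B) :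
    antiIso (revIso τ) (antiIso τ b) = b := by
  simp [antiIso, revIso, AlgEquiv.opComm]

@[simp] lemma antiIso_antiIso_revIso (τ : A ≃ₐ[k] Bᵐᵒᵖ) (a : A) :
    antiIso τ (antiIso (revIso τ) a) = a := by
  simp [antiIso, revIso, AlgEquiv.opComm]

variable (τ : A ≃ₐ[k] Bᵐᵒᵖ)

@[simp] lemma antiIso_one : antiIso τ 1 = 1 := by simp [antiIso]
@[simp] lemma antiIso_zero : antiIso τ 0 = 0 := by simp [antiIso]
@[simp] lemma antiIso_mul (b c : B) : antiIso τ (b * c) = antiIso τ c * antiIso τ b := by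
  simp [antiIso]
@[simp] lemma antiIso_add (b c : B) : antiIso τ (b + c) = antiIso τ b + antiIso τ c := by
  simp [antiIso]
@[simp] lemma antiIso_algebraMap (c : k) : antiIso τ (algebraMap k B c) = algebraMap k A c := by
  rw [antiIso, ← MulOpposite.algebraMap_apply, AlgEquiv.commutes]

/-- The `k`-linear functionals on an `A`-module `M`, where `k` acts through `A`. -/
def linearFunctionals (k A : Type u) [Field k] [Ring A] [Algebra k A] (M : Type u)
    [AddCommGroup M] [Module A M] : AddSubgroup (M →+ k) where
  carrier := {φ | ∀ (c : k) (m : M), φ (algebraMap k A c • m) = c * φ m}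
  zero_mem' := by simp
  add_mem' hφ hψ c m := by simp [hφ c m, hψ c m, mul_add]
  neg_mem' hφ c m := by simp [hφ c m]

/-- The dual `Hom_k(M, k)` of an `A`-module `M`, a module over the opposite algebra `B` of `A`.
The vector space structure of `M` is the one restricted from `A`, so that the dual depends on the
`A`-module `M` alone. -/
def OpDual (_ : A ≃ₐ[k] Bᵐᵒᵖ) (M : Type u) [AddCommGroup M] [Module A M] : Type u :=
  linearFunctionals k A M

variable {τ} {M N P : Type u} [AddCommGroup M] [Module A M] [AddCommGroup N] [Module A N]
  [AddCommGroup P] [Module A P]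

namespace OpDual

noncomputable instance : AddCommGroup (OpDual τ M) :=
  inferInstanceAs (AddCommGroup (linearFunctionals k A M))

instance : FunLike (OpDual τ M) M k where
  coe φ := φ.1
  coe_injective _ _ h := Subtype.ext (DFunLike.coe_injective h)

instance : AddMonoidHomClass (OpDual τ M) M k where
  map_add φ := AddMonoidHom.map_add φ.1
  map_zero φ := AddMonoidHom.map_zero φ.1

lemma map_algebraMap_smul (φ : OpDual τ M) (c : k) (m : M) :
    φ (algebraMap k A c • m) = c * φ m := φ.2 c m

/-- A functional on `M`, from its additivity and its compatibility with scalars. -/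
def mk (τ : A ≃ₐ[k] Bᵐᵒᵖ) (φ : M → k) (h : ∀ x y, φ (x + y) = φ x + φ y)
    (h' : ∀ (c : k) m, φ (algebraMap k A c • m) = c * φ m) : OpDual τ M :=
  ⟨AddMonoidHom.mk' φ h, h'⟩

@[simp] lemma mk_apply (φ : M → k) (h h') (m : M) : mk τ φ h h' m = φ m := rfl

@[ext] lemma ext {φ ψ : OpDual τ M} (h : ∀ m, φ m = ψ m) : φ = ψ := DFunLike.ext _ _ h

@[simp] lemma add_apply (φ ψ : OpDual τ M) (m : M) : (φ + ψ) m = φ m + ψ m := rfl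
@[simp] lemma zero_apply (m : M) : (0 : OpDual τ M) m = 0 := rfl

noncomputable instance : Module B (OpDual τ M) where
  smul b φ := mk τ (fun m => φ (antiIso τ b • m)) (by simp) (fun c m => by
    rw [← map_algebraMap_smul, smul_smul, smul_smul, Algebra.commutes])
  one_smul φ := by ext m; change φ (antiIso τ 1 • m) = _; simp
  mul_smul b c φ := by
    ext m; change φ (antiIso τ (b * c) • m) = φ (antiIso τ c • antiIso τ b • m)
    simp [mul_smul]
  smul_zero b := by ext m; rfl
  smul_add b φ ψ := by ext m; rfl
  add_smul b c φ := by
    ext m; change φ (antiIso τ (b + c) • m) = φ (antiIso τ b • m) + φ (antiIso τ c • m)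
    simp [add_smul]
  zero_smul φ := by ext m; change φ (antiIso τ 0 • m) = 0; simp

@[simp] lemma smul_apply (b : B) (φ : OpDual τ M) (m : M) : (b • φ) m = φ (antiIso τ b • m) := rfl

/-- The transpose of a linear map. -/
def map (τ : A ≃ₐ[k] Bᵐᵒᵖ) (f : M →ₗ[A] N) : OpDual τ N →ₗ[B] OpDual τ M where
  toFun φ := mk τ (fun m => φ (f m)) (by simp) (by simp [map_algebraMap_smul])
  map_add' _ _ := rfl
  map_smul' b φ := by ext m; simp

@[simp] lemma map_apply (f : M →ₗ[A] N) (φ : OpDual τ N) (m : M) : map τ f φ m = φ (f m) := rfl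

lemma exists_apply_ne_zero (τ : A ≃ₐ[k] Bᵐᵒᵖ) {m : M} (hm : m ≠ 0) :
    ∃ φ : OpDual τ M, φ m ≠ 0 := by
  let := Module.compHom M (algebraMap k A)
  by_contra! h
  refine hm ((Module.forall_dual_apply_eq_zero_iff k m).1 fun φ => ?_)
  exact h (mk τ φ (by simp) φ.map_smul)

lemma map_surjective {f : M →ₗ[A] N} (hf : Function.Injective f) :
    Function.Surjective (map τ f) := by
  let := Module.compHom M (algebraMap k A)
  let := Module.compHom N (algebraMap k A)
  let f' : M →ₗ[k] N :=
    { toFun := f, map_add' := f.map_add, map_smul' := fun c m => f.map_smul _ m }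
  intro φ
  obtain ⟨ψ, hψ⟩ := LinearMap.dualMap_surjective_of_injective (f := f') hf
    { toFun := φ, map_add' := map_add φ, map_smul' := map_algebraMap_smul φ }
  exact ⟨mk τ ψ (by simp) ψ.map_smul, ext fun m => DFunLike.congr_fun hψ m⟩

lemma map_injective {f : M →ₗ[A] N} (hf : Function.Surjective f) :
    Function.Injective (map τ f) := by
  intro φ ψ h
  ext n
  obtain ⟨m, rfl⟩ := hf n
  exact DFunLike.congr_fun h m

lemma map_exact {f : M →ₗ[A] N} {g : N →ₗ[A] P} (hg : Function.Surjective g)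
    (h : Function.Exact f g) : Function.Exact (map τ g) (map τ f) := by
  intro φ
  constructor
  · intro hφ
    have key : ∀ x y, g x = g y → φ x = φ y := by
      intro x y hxy
      obtain ⟨m, hm⟩ := (h (x - y)).1 (by simp [hxy])
      have := DFunLike.congr_fun hφ m
      rw [map_apply, hm, map_sub] at this
      exact sub_eq_zero.1 this
    have hs := Function.surjInv_eq hg
    refine ⟨mk τ (fun p => φ (Function.surjInv hg p)) (fun x y => ?_) (fun c x => ?_), ?_⟩
    · rw [← map_add]; exact key _ _ (by simp [hs])
    · rw [← map_algebraMap_smul]; exact key _ _ (by simp [hs])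
    · ext n; exact key _ _ (hs _)
  · rintro ⟨ψ, rfl⟩
    ext m
    simp [h.apply_apply_eq_zero]

/-- Evaluation into the double dual. -/
def eval (τ : A ≃ₐ[k] Bᵐᵒᵖ) (M : Type u) [AddCommGroup M] [Module A M] :
    M →ₗ[A] OpDual (revIso τ) (OpDual τ M) where
  toFun m := mk _ (fun φ => φ m) (by simp) (by simp [map_algebraMap_smul])
  map_add' x y := by ext φ; exact map_add φ x y
  map_smul' a m := by ext φ; change φ (a • m) = φ (_ • m); simp

@[simp] lemma eval_apply (m : M) (φ : OpDual τ M) : eval τ M m φ = φ m := rfl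

lemma eval_injective : Function.Injective (eval τ M) := by
  rw [injective_iff_map_eq_zero]
  intro m hm
  by_contra h
  obtain ⟨φ, hφ⟩ := exists_apply_ne_zero τ h
  exact hφ (DFunLike.congr_fun hm φ)

lemma finiteDimensional_of_finite [FiniteDimensional k A] [Module.Finite A M] :
    letI := Module.compHom M (algebraMap k A)
    FiniteDimensional k M := by
  let := Module.compHom M (algebraMap k A)
  have : IsScalarTower k A M := ⟨fun c a m => by
    change (c • a) • m = algebraMap k A c • a • m
    rw [Algebra.smul_def, mul_smul]⟩
  exact Module.Finite.trans A M

lemma finite_of_finiteDimensional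
    (h : letI := Module.compHom M (algebraMap k A); FiniteDimensional k M) :
    Module.Finite A M := by
  let := Module.compHom M (algebraMap k A)
  have : IsScalarTower k A M := ⟨fun c a m => by
    change (c • a) • m = algebraMap k A c • a • m
    rw [Algebra.smul_def, mul_smul]⟩
  exact Module.Finite.of_restrictScalars_finite k A M

lemma eval_surjective [FiniteDimensional k A] [Module.Finite A M] :
    Function.Surjective (eval τ M) := by
  let := Module.compHom M (algebraMap k A)
  have : FiniteDimensional k M := finiteDimensional_of_finite (A := A)
  intro Φ
  let Φ' : Module.Dual k (Module.Dual k M) :=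
    { toFun := fun φ => Φ (mk τ φ (by simp) φ.map_smul)
      map_add' := fun φ ψ => by rw [← map_add]; rfl
      map_smul' := fun c φ => by
        rw [smul_eq_mul, RingHom.id_apply, ← map_algebraMap_smul]
        congr 1
        ext m
        simp [map_algebraMap_smul] }
  obtain ⟨m, hm⟩ := (Module.bijective_dual_eval k M).2 Φ'
  refine ⟨m, OpDual.ext fun φ => ?_⟩
  exact DFunLike.congr_fun hm
    { toFun := φ, map_add' := map_add φ, map_smul' := map_algebraMap_smul φ }

instance [FiniteDimensional k A] [Module.Finite A M] : Module.Finite B (OpDual τ M) := by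
  let := Module.compHom M (algebraMap k A)
  have : FiniteDimensional k M := finiteDimensional_of_finite (A := A)
  apply finite_of_finiteDimensional (k := k)
  let := Module.compHom (OpDual τ M) (algebraMap k B)
  let F : OpDual τ M →ₗ[k] M →ₗ[k] k :=
    { toFun := fun φ =>
        { toFun := φ, map_add' := map_add φ, map_smul' := map_algebraMap_smul φ }
      map_add' := fun _ _ => rfl
      map_smul' := fun c φ => by
        ext m
        change φ (antiIso τ (algebraMap k B c) • m) = c * φ m
        rw [antiIso_algebraMap, map_algebraMap_smul] }
  exact Module.Finite.of_injective F fun φ ψ h => ext fun m => DFunLike.congr_fun h m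

/-- A finitely generated module is isomorphic to its double dual. -/
noncomputable def evalEquiv (τ : A ≃ₐ[k] Bᵐᵒᵖ) (M : Type u) [AddCommGroup M] [Module A M]
    [FiniteDimensional k A] [Module.Finite A M] :
    M ≃ₗ[A] OpDual (revIso τ) (OpDual τ M) :=
  LinearEquiv.ofBijective (eval τ M) ⟨eval_injective, eval_surjective⟩

@[simp] lemma evalEquiv_apply [FiniteDimensional k A] [Module.Finite A M] (m : M)
    (φ : OpDual τ M) : evalEquiv τ M m φ = φ m := rfl

variable {Q : Type u} [AddCommGroup Q] [Module B Q]

/-- The dual on `A`-modules and the dual on `B`-modules are adjoint on the right. -/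
def flip (s : Q →ₗ[B] OpDual τ M) : M →ₗ[A] OpDual (revIso τ) Q where
  toFun m := mk _ (fun q => s q m) (by simp) (by simp [map_algebraMap_smul])
  map_add' x y := by ext q; exact map_add (s q) x y
  map_smul' a m := by
    ext q
    change s q (a • m) = s (antiIso (revIso τ) a • q) m
    simp

@[simp] lemma flip_apply (s : Q →ₗ[B] OpDual τ M) (m : M) (q : Q) : flip s m q = s q m := rfl

/-- The inverse of `OpDual.flip`. -/
def unflip (s : M →ₗ[A] OpDual (revIso τ) Q) : Q →ₗ[B] OpDual τ M where
  toFun q := mk _ (fun m => s m q) (by simp) (by simp [map_algebraMap_smul])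
  map_add' x y := by ext m; exact map_add (s m) x y
  map_smul' b q := by
    ext m
    change s m (b • q) = s (antiIso τ b • m) q
    simp

/-- The duality is full. -/
lemma exists_map_eq [FiniteDimensional k A] [Module.Finite A N]
    (s : OpDual τ N →ₗ[B] OpDual τ M) : ∃ t : M →ₗ[A] N, map τ t = s := by
  refine ⟨(evalEquiv τ N).symm.toLinearMap ∘ₗ flip s, ?_⟩
  ext φ m
  rw [map_apply, ← evalEquiv_apply]
  simp

/-- The duality is faithful. -/
lemma map_inj {f g : M →ₗ[A] N} (h : map τ f = map τ g) : f = g := by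
  ext m
  apply eval_injective (τ := τ)
  ext φ
  exact DFunLike.congr_fun (DFunLike.congr_fun h φ) m

/-- Isomorphic modules have isomorphic duals. -/
def mapEquiv (τ : A ≃ₐ[k] Bᵐᵒᵖ) (e : M ≃ₗ[A] N) : OpDual τ N ≃ₗ[B] OpDual τ M :=
  LinearEquiv.ofLinearMap (map τ e) (map τ e.symm)
    (by ext; simp) (by ext; simp)

/-- The dual of a projective module is injective: flipping turns an extension problem into the dual
into a lifting problem along the transpose of the inclusion. -/
lemma injective_of_projective [Module.Projective A P] : Module.Injective B (OpDual τ P) where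
  out X Y _ _ _ _ i hi f := by
    obtain ⟨g, hg⟩ := Module.projective_lifting_property (map (revIso τ) i) (flip f)
      (map_surjective hi)
    refine ⟨unflip g, fun x => ?_⟩
    ext m
    exact DFunLike.congr_fun (DFunLike.congr_fun hg m) x

end OpDual

section Injective

lemma Module.Injective.of_split {I J : Type u} [AddCommGroup I] [Module A I] [AddCommGroup J]
    [Module A J] [Module.Injective A J] (i : I →ₗ[A] J) (r : J →ₗ[A] I)
    (h : ∀ x, r (i x) = x) : Module.Injective A I where
  out X Y _ _ _ _ j hj f := by
    obtain ⟨g, hg⟩ := Module.Injective.out (Q := J) j hj (i ∘ₗ f)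
    exact ⟨r ∘ₗ g, fun x => by simp [hg, h]⟩

lemma Module.Injective.of_linearEquiv {I J : Type u} [AddCommGroup I] [Module A I]
    [AddCommGroup J] [Module A J] [Module.Injective A J] (e : I ≃ₗ[A] J) :
    Module.Injective A I :=
  .of_split e.toLinearMap e.symm.toLinearMap (by simp)

/-- An injective submodule splits off. -/
lemma Module.Injective.exists_retraction {I J : Type u} [AddCommGroup I] [Module A I]
    [AddCommGroup J] [Module A J] [Module.Injective A I] (i : I →ₗ[A] J)
    (hi : Function.Injective i) : ∃ r : J →ₗ[A] I, ∀ x, r (i x) = x :=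
  Module.Injective.out i hi LinearMap.id

end Injective

namespace OpDual

/-- The dual of a finitely generated injective module is projective: a free cover of the dual is
split, because its transpose is a split embedding of the double dual. -/
lemma projective_of_injective [FiniteDimensional k A] [FiniteDimensional k B]
    [Module.Finite A M] [Module.Injective A M] :
    Module.Projective B (OpDual τ M) := by
  obtain ⟨n, p, hp⟩ := Module.Finite.exists_fin' B (OpDual τ M)
  have : Module.Injective A (OpDual (revIso τ) (OpDual τ M)) :=
    .of_linearEquiv (evalEquiv τ M).symm
  obtain ⟨r, hr⟩ := Module.Injective.exists_retraction (map (revIso τ) p) (map_injective hp)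
  obtain ⟨t, rfl⟩ := exists_map_eq r
  refine Module.Projective.of_split t p ?_
  apply map_inj (τ := revIso τ)
  ext1 x
  exact hr x

/-- Every finitely generated module embeds into a finitely generated injective module. -/
lemma exists_injective_embedding [FiniteDimensional k A] [FiniteDimensional k B]
    (τ : A ≃ₐ[k] Bᵐᵒᵖ) (M : Type u) [AddCommGroup M] [Module A M] [Module.Finite A M] :
    ∃ (J : ModuleCat.{u} A) (i : M →ₗ[A] J), Module.Injective A J ∧ Module.Finite A J ∧
      Function.Injective i := by
  obtain ⟨n, p, hp⟩ := Module.Finite.exists_fin' B (OpDual τ M)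
  refine ⟨ModuleCat.of A (OpDual (revIso τ) (Fin n → B)), map (revIso τ) p ∘ₗ eval τ M,
    injective_of_projective, inferInstanceAs (Module.Finite A (OpDual (revIso τ) (Fin n → B))),
    (map_injective hp).comp eval_injective⟩

end OpDual

end Duality

/-! ### Left-right symmetry of self-injectivity -/

section SimpleModules

variable {A : Type u} [Ring A]

lemma nonempty_linearEquiv_of_annihilator_le {S T : Type u} [AddCommGroup S] [Module A S]
    [AddCommGroup T] [Module A T] [IsSimpleModule A S] [IsSimpleModule A T] {s : S} {t : T}
    (hs : s ≠ 0) (ht : t ≠ 0) (h : ∀ a : A, a • s = 0 → a • t = 0) :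
    Nonempty (S ≃ₗ[A] T) := by
  have hsurj := IsSimpleModule.toSpanSingleton_surjective A hs
  let e := (LinearMap.toSpanSingleton A S s).quotKerEquivOfSurjective hsurj
  have hle : LinearMap.ker (LinearMap.toSpanSingleton A S s) ≤
      LinearMap.ker (LinearMap.toSpanSingleton A T t) := fun a ha => h a ha
  let g : S →ₗ[A] T :=
    Submodule.liftQ _ (LinearMap.toSpanSingleton A T t) hle ∘ₗ e.symm.toLinearMap
  have he : e.symm s = Submodule.Quotient.mk 1 := by
    rw [LinearEquiv.symm_apply_eq]
    simp [e]
  have hg : g s = t := by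
    change Submodule.liftQ _ _ hle (e.symm s) = t
    rw [he, Submodule.liftQ_apply]
    simp
  rcases g.bijective_or_eq_zero with hb | h0
  · exact ⟨LinearEquiv.ofBijective g hb⟩
  · rw [h0] at hg
    exact absurd hg.symm ht

/-- Maximal left ideals are related if their quotients are isomorphic, so that the classes are the
isomorphism classes of simple modules. -/
def simpleSetoid (A : Type u) [Ring A] : Setoid {m : Submodule A A // IsCoatom m} where
  r m m' := Nonempty ((A ⧸ m.1) ≃ₗ[A] (A ⧸ m'.1))
  iseqv := ⟨fun _ => ⟨.refl _ _⟩, fun ⟨e⟩ => ⟨e.symm⟩, fun ⟨e⟩ ⟨f⟩ => ⟨e.trans f⟩⟩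

/-- Up to isomorphism, only finitely many simple modules receive a nonzero map from a module of
finite length. -/
lemma exists_finite_simple_targets {M : Type u} [AddCommGroup M] [Module A M]
    (h : IsFiniteLength A M) :
    ∃ s : Set (Quotient (simpleSetoid A)), s.Finite ∧
      ∀ (m : {m : Submodule A A // IsCoatom m}) (f : M →ₗ[A] A ⧸ m.1), f ≠ 0 →
        Quotient.mk (simpleSetoid A) m ∈ s := by
  induction h with
  | of_subsingleton =>
    refine ⟨∅, Set.finite_empty, fun m f hf => (hf ?_).elim⟩
    ext x
    rw [Subsingleton.elim x 0]; simp
  | @of_simple_quotient M _ _ N _ _ ih =>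
    obtain ⟨s, hs, h⟩ := ih
    let t : Set (Quotient (simpleSetoid A)) :=
      {q | ∃ m, Nonempty ((A ⧸ m.1) ≃ₗ[A] (M ⧸ N)) ∧ Quotient.mk (simpleSetoid A) m = q}
    have ht : t.Subsingleton := by
      rintro _ ⟨m, ⟨e⟩, rfl⟩ _ ⟨m', ⟨e'⟩, rfl⟩
      exact Quotient.sound ⟨e.trans e'.symm⟩
    refine ⟨s ∪ t, hs.union ht.finite, fun m f hf => ?_⟩
    by_cases h0 : f ∘ₗ N.subtype = 0
    · right
      have : IsSimpleModule A (A ⧸ m.1) := isSimpleModule_iff_isCoatom.2 m.2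
      let g : (M ⧸ N) →ₗ[A] A ⧸ m.1 :=
        N.liftQ f (fun x hx => LinearMap.mem_ker.2 (DFunLike.congr_fun h0 ⟨x, hx⟩))
      rcases g.bijective_or_eq_zero with hb | hz
      · exact ⟨m, ⟨(LinearEquiv.ofBijective g hb).symm⟩, rfl⟩
      · refine (hf ?_).elim
        ext x
        exact DFunLike.congr_fun hz (N.mkQ x)
    · exact Or.inl (h m _ h0)

/-- An Artinian ring has finitely many simple modules up to isomorphism. -/
lemma finite_simpleSetoid (A : Type u) [Ring A] [IsArtinianRing A] :
    Finite (Quotient (simpleSetoid A)) := by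
  have hl : IsFiniteLength A A :=
    isFiniteLength_iff_isNoetherian_isArtinian.2 ⟨inferInstance, inferInstance⟩
  obtain ⟨s, hs, h⟩ := exists_finite_simple_targets hl
  refine Set.finite_univ_iff.1 (hs.subset fun q _ => ?_)
  induction q using Quotient.inductionOn with
  | h m =>
    refine h m m.1.mkQ fun h0 => m.2.1 ?_
    rw [← Submodule.ker_mkQ m.1, h0, LinearMap.ker_zero]

/-- Over a self-injective ring, the right ideal generated by a generator of a simple left ideal is
simple. -/
lemma exists_mul_mul_eq_of_isSimpleModule_span [Module.Injective A A] {y c : A}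
    (hy : IsSimpleModule A (Submodule.span A {y})) (hc : y * c ≠ 0) : ∃ d, y * c * d = y := by
  let f : Submodule.span A {y} →ₗ[A] A :=
    (LinearMap.toSpanSingleton A A c) ∘ₗ (Submodule.span A {y}).subtype
  let y' : Submodule.span A {y} := ⟨y, Submodule.mem_span_singleton_self y⟩
  have hf : Function.Injective f := by
    rcases f.injective_or_eq_zero with h | h
    · exact h
    · exact (hc (DFunLike.congr_fun h y')).elim
  obtain ⟨g, hg⟩ := Module.Injective.out (Q := A) f hf (Submodule.span A {y}).subtype
  refine ⟨g 1, ?_⟩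
  have := hg y'
  change g (y * c) = y at this
  rwa [← smul_eq_mul (y * c) (g 1), ← map_smul, smul_eq_mul, mul_one]

end SimpleModules

section Symmetry

variable {k A B : Type u} [Field k] [Ring A] [Ring B] [Algebra k A] [Algebra k B]
  {τ : A ≃ₐ[k] Bᵐᵒᵖ}

lemma OpDual.isSimpleModule [FiniteDimensional k A] (τ : A ≃ₐ[k] Bᵐᵒᵖ) (S : Type u)
    [AddCommGroup S] [Module A S] [IsSimpleModule A S] : IsSimpleModule B (OpDual τ S) := by
  have : Nontrivial S := IsSimpleModule.nontrivial A S
  obtain ⟨s, hs⟩ := exists_ne (0 : S)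
  obtain ⟨φ, hφ⟩ := OpDual.exists_apply_ne_zero τ hs
  have : Nontrivial (OpDual τ S) := ⟨φ, 0, fun h => hφ (by simp [h])⟩
  refine isSimpleModule_iff_toSpanSingleton_surjective.2 ⟨this, fun φ hφ => ?_⟩
  rw [← LinearMap.range_eq_top]
  by_contra hW
  set W := LinearMap.range (LinearMap.toSpanSingleton B (OpDual τ S) φ)
  obtain ⟨ψ, hψ⟩ : ∃ ψ, ψ ∉ W := by
    by_contra! h
    exact hW (eq_top_iff.2 fun x _ => h x)
  -- A functional on the dual that vanishes on `W` is evaluation at some `s`.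
  obtain ⟨Φ, hΦ⟩ := OpDual.exists_apply_ne_zero (revIso τ) (m := W.mkQ ψ) (by simpa using hψ)
  obtain ⟨s, hs⟩ := OpDual.eval_surjective (OpDual.map (revIso τ) W.mkQ Φ)
  have hs0 : s ≠ 0 := by
    rintro rfl
    apply hΦ
    rw [← OpDual.map_apply, ← hs]; simp
  apply hφ
  ext x
  obtain ⟨a, rfl⟩ := IsSimpleModule.toSpanSingleton_surjective A hs0 x
  have := DFunLike.congr_fun hs (antiIso (revIso τ) a • φ)
  have h0 : W.mkQ (antiIso (revIso τ) a • φ) = 0 := by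
    rw [Submodule.mkQ_apply, Submodule.Quotient.mk_eq_zero]
    exact ⟨_, rfl⟩
  rw [OpDual.map_apply, h0, map_zero] at this
  simpa using this

/-- Every simple module over the opposite of a self-injective algebra is isomorphic to the right
ideal generated by some `y` for which the left ideal generated by `y` is simple. -/
lemma exists_isSimpleModule_span [IsArtinianRing A] [Module.Injective A A]
    (τ : A ≃ₐ[k] Bᵐᵒᵖ) (T : Type u) [AddCommGroup T] [Module B T] [IsSimpleModule B T] :
    ∃ y : A, IsSimpleModule A (Submodule.span A {y}) ∧ ∃ t : T, t ≠ 0 ∧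
      ∀ c : A, y * c = 0 ↔ antiIso (revIso τ) c • t = 0 := by
  have : Nontrivial T := IsSimpleModule.nontrivial B T
  obtain ⟨t, ht⟩ := exists_ne (0 : T)
  -- Choose `b` with `t b ≠ 0` whose left annihilator is maximal, and `y = x b` in a simple
  -- submodule of `A b`. If `y c = 0` but `t b c ≠ 0`, then `b c` has a larger left annihilator.
  let 𝒮 : Set (Submodule A A) :=
    {L | ∃ b : A, antiIso (revIso τ) b • t ≠ 0 ∧
      LinearMap.ker (LinearMap.toSpanSingleton A A b) = L}
  obtain ⟨_, ⟨b, hbt, rfl⟩, hmax⟩ :=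
    set_has_maximal_iff_noetherian.2 (inferInstanceAs (IsNoetherian A A)) 𝒮
      ⟨_, 1, by simpa using ht, rfl⟩
  have hb : b ≠ 0 := by rintro rfl; simp at hbt
  obtain ⟨S, hSb, hS⟩ : ∃ S : Submodule A A, IsAtom S ∧ S ≤ Submodule.span A {b} := by
    obtain h | ⟨S, h⟩ := eq_bot_or_exists_atom_le (Submodule.span A {b})
    · simp [hb] at h
    · exact ⟨S, h⟩
  obtain ⟨y, hyS, hy0⟩ := Submodule.exists_mem_ne_zero_of_ne_bot hSb.1
  have hSy : Submodule.span A {y} = S := by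
    refine (hSb.le_iff.1 ?_).resolve_left (by simpa using hy0)
    simpa using hyS
  obtain ⟨x, rfl⟩ := Submodule.mem_span_singleton.1 (hS hyS)
  have hsimple : IsSimpleModule A (Submodule.span A {x • b}) := by
    rw [hSy]; exact isSimpleModule_iff_isAtom.2 hSb
  have hzero : ∀ c : A, x • b * c = 0 → antiIso (revIso τ) c • antiIso (revIso τ) b • t = 0 := by
    intro c hc
    by_contra hne
    rw [smul_smul, ← antiIso_mul] at hne
    refine hmax _ ⟨b * c, hne, rfl⟩ (lt_of_le_of_ne ?_ fun heq => hy0 ?_)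
    · intro a ha
      simp only [LinearMap.mem_ker, LinearMap.toSpanSingleton_apply, smul_eq_mul] at ha ⊢
      rw [← mul_assoc, ha, zero_mul]
    · have : x ∈ LinearMap.ker (LinearMap.toSpanSingleton A A (b * c)) := by
        simpa [mul_assoc] using hc
      rw [← heq] at this
      simpa using this
  refine ⟨x • b, hsimple, _, hbt, fun c => ⟨hzero c, fun hc => ?_⟩⟩
  by_contra hne
  obtain ⟨d, hd⟩ := exists_mul_mul_eq_of_isSimpleModule_span hsimple hne
  have := hzero (c * d - 1) (by rw [mul_sub, ← mul_assoc, hd, mul_one, sub_self])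
  apply hbt
  rw [sub_eq_add_neg, antiIso_add, add_smul, antiIso_mul, mul_smul, hc, smul_zero, zero_add] at this
  simpa [antiIso] using this

/-- The simple right ideal generated by `y` is determined by the simple left ideal generated
by `y`. -/
lemma nonempty_linearEquiv_of_span [Module.Injective A A] {T T' : Type u}
    [AddCommGroup T] [Module B T] [IsSimpleModule B T]
    [AddCommGroup T'] [Module B T'] [IsSimpleModule B T'] {y y' : A} {t : T} {t' : T'}
    (ht' : t' ≠ 0)
    (h : ∀ c : A, y * c = 0 ↔ antiIso (revIso τ) c • t = 0)
    (h' : ∀ c : A, y' * c = 0 ↔ antiIso (revIso τ) c • t' = 0)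
    (e : Submodule.span A {y} ≃ₗ[A] Submodule.span A {y'}) : Nonempty (T ≃ₗ[B] T') := by
  -- An isomorphism between left ideals of a self-injective ring is a right multiplication.
  obtain ⟨g, hg⟩ := Module.Injective.out (Q := A) (Submodule.span A {y}).subtype
    Subtype.val_injective ((Submodule.span A {y'}).subtype ∘ₗ e.toLinearMap)
  let c := g 1
  have hc : ∀ x : Submodule.span A {y}, (e x : A) = x * c := by
    intro x
    have := hg x
    simp only [Submodule.subtype_apply, LinearMap.comp_apply, LinearEquiv.coe_coe] at this
    rw [← this, ← smul_eq_mul, ← map_smul, smul_eq_mul, mul_one]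
  obtain ⟨x, hx⟩ := e.surjective ⟨y', Submodule.mem_span_singleton_self y'⟩
  obtain ⟨a, ha⟩ := Submodule.mem_span_singleton.1 x.2
  have hy' : y' = a * (y * c) := by
    rw [← mul_assoc, ← smul_eq_mul a, ha, ← hc, hx]
  have hyne' : y' ≠ 0 := by
    rintro rfl
    apply ht'
    simpa [antiIso] using (h' 1).1 (by simp)
  have hyc : y * c ≠ 0 := fun h0 => hyne' (by rw [hy', h0, mul_zero])
  refine nonempty_linearEquiv_of_annihilator_le (s := antiIso (revIso τ) c • t) (t := t')
    (fun h0 => hyc ((h c).2 h0)) ht' fun b hb => ?_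
  obtain ⟨r, rfl⟩ : ∃ r, antiIso (revIso τ) r = b := ⟨antiIso τ b, by simp⟩
  rw [smul_smul, ← antiIso_mul] at hb
  rw [← h', hy', mul_assoc, mul_assoc, (h _).2 hb, mul_zero]

/-- Over a self-injective algebra every simple module is isomorphic to a left ideal. The simple
modules `S` are in bijection with the simple right modules `D S`, and each of these is `yA` for some
`y` with `Ay` simple; the resulting map `S ↦ Ay` is injective on isomorphism classes, of which there
are finitely many, so it is surjective. -/
lemma exists_injective_of_isCoatom [FiniteDimensional k A] [Module.Injective A A]
    (τ : A ≃ₐ[k] Bᵐᵒᵖ) (m : Submodule A A) (hm : IsCoatom m) :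
    ∃ j : (A ⧸ m) →ₗ[A] A, Function.Injective j := by
  have : IsArtinianRing A := IsArtinianRing.of_finite k A
  have hsim (m : {m : Submodule A A // IsCoatom m}) : IsSimpleModule A (A ⧸ m.1) :=
    isSimpleModule_iff_isCoatom.2 m.2
  have hdual (m : {m : Submodule A A // IsCoatom m}) := OpDual.isSimpleModule τ (A ⧸ m.1)
  choose y hy t ht h using fun m : {m : Submodule A A // IsCoatom m} =>
    exists_isSimpleModule_span τ (OpDual τ (A ⧸ m.1))
  let e (m) : (A ⧸ LinearMap.ker (LinearMap.toSpanSingleton A A (y m))) ≃ₗ[A]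
      Submodule.span A {y m} :=
    (LinearMap.quotKerEquivRange _).trans
      (LinearEquiv.ofEq _ _ (LinearMap.range_toSpanSingleton _))
  let G (m : {m : Submodule A A // IsCoatom m}) : {m : Submodule A A // IsCoatom m} :=
    ⟨LinearMap.ker (LinearMap.toSpanSingleton A A (y m)), by
      have := hy m
      exact isSimpleModule_iff_isCoatom.1 (IsSimpleModule.congr (e m))⟩
  have hfin := finite_simpleSetoid A
  have hinj : Function.Injective
      (fun q : Quotient (simpleSetoid A) => Quotient.mk (simpleSetoid A) (G q.out)) := by
    intro q q' hq
    obtain ⟨f⟩ := Quotient.exact hq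
    obtain ⟨g⟩ := nonempty_linearEquiv_of_span (ht q'.out) (h q.out) (h q'.out)
      ((e q.out).symm.trans (f.trans (e q'.out)))
    have := Quotient.sound (s := simpleSetoid A) (a := q.out) (b := q'.out)
      ⟨(OpDual.evalEquiv τ _).trans
        ((OpDual.mapEquiv (revIso τ) g.symm).trans (OpDual.evalEquiv τ _).symm)⟩
    simpa using this
  obtain ⟨q, hq⟩ := Finite.surjective_of_injective hinj (Quotient.mk (simpleSetoid A) ⟨m, hm⟩)
  obtain ⟨f⟩ := Quotient.exact hq
  exact ⟨(Submodule.span A {y q.out}).subtype ∘ₗ (f.symm.trans (e q.out)).toLinearMap,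
    Subtype.val_injective.comp (LinearEquiv.injective _)⟩

/-- A self-injective algebra is a cogenerator. -/
lemma exists_linearMap_apply_ne_zero [FiniteDimensional k A] [Module.Injective A A]
    (τ : A ≃ₐ[k] Bᵐᵒᵖ) {M : Type u} [AddCommGroup M] [Module A M] {x : M} (hx : x ≠ 0) :
    ∃ f : M →ₗ[A] A, f x ≠ 0 := by
  let p := LinearMap.toSpanSingleton A M x
  have hp : LinearMap.ker p ≠ ⊤ := by
    intro h
    have : (1 : A) ∈ LinearMap.ker p := h ▸ Submodule.mem_top
    exact hx (by simpa [p] using this)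
  obtain ⟨m, hm, hle⟩ := (eq_top_or_exists_le_coatom (LinearMap.ker p)).resolve_left hp
  obtain ⟨j, hj⟩ := exists_injective_of_isCoatom τ m hm
  obtain ⟨f, hf⟩ := Module.Injective.out (Q := A) ((LinearMap.ker p).liftQ p le_rfl)
    (LinearMap.ker_eq_bot.1 (Submodule.ker_liftQ_eq_bot _ _ _ le_rfl))
    (j ∘ₗ Submodule.factor hle)
  refine ⟨f, fun h0 => hm.1 ?_⟩
  have h1 := hf ((LinearMap.ker p).mkQ 1)
  have hp1 : p 1 = x := by simp [p]
  rw [Submodule.mkQ_apply, Submodule.liftQ_apply, hp1, h0, LinearMap.comp_apply] at h1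
  have h2 := (injective_iff_map_eq_zero j).1 hj _ h1.symm
  have h3 : (1 : A) ∈ m := by
    rw [← Submodule.Quotient.mk_eq_zero]; exact h2
  rw [Submodule.eq_top_iff']
  intro a
  simpa using m.smul_mem a h3

/-- Over a self-injective algebra, finitely generated injective modules are projective. -/
lemma projective_of_finite_of_injective [FiniteDimensional k A] [Module.Injective A A]
    (τ : A ≃ₐ[k] Bᵐᵒᵖ) (M : Type u) [AddCommGroup M] [Module A M] [Module.Finite A M]
    [Module.Injective A M] : Module.Projective A M := by
  have : IsArtinianRing A := IsArtinianRing.of_finite k A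
  -- A map to a projective module with minimal kernel is injective, since `A` is a cogenerator.
  let 𝒦 : Set (Submodule A M) :=
    {K | ∃ P : ModuleCat.{u} A, Module.Projective A P ∧ ∃ f : M →ₗ[A] P, LinearMap.ker f = K}
  obtain ⟨_, ⟨P, hP, f, rfl⟩, hmin⟩ := IsArtinian.set_has_minimal 𝒦
    ⟨_, ModuleCat.of A A, inferInstanceAs (Module.Projective A A), (0 : M →ₗ[A] A), rfl⟩
  have hf : Function.Injective f := by
    rw [← LinearMap.ker_eq_bot]
    by_contra hne
    obtain ⟨x, hx, hx0⟩ := Submodule.exists_mem_ne_zero_of_ne_bot hne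
    obtain ⟨g, hg⟩ := exists_linearMap_apply_ne_zero τ hx0
    refine hmin _ ⟨ModuleCat.of A (P × A), inferInstanceAs (Module.Projective A (P × A)),
      f.prod g, rfl⟩ (lt_of_le_of_ne ?_ fun heq => hg ?_)
    · rw [LinearMap.ker_prod]; exact inf_le_left
    · rw [← heq, LinearMap.ker_prod] at hx
      exact hx.2
  obtain ⟨r, hr⟩ := Module.Injective.exists_retraction f hf
  exact Module.Projective.of_split f r (LinearMap.ext hr)

/-- Self-injectivity of a finite-dimensional algebra is left-right symmetric. -/
theorem IsSelfInjective.opposite [FiniteDimensional k A] [FiniteDimensional k B]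
    (τ : A ≃ₐ[k] Bᵐᵒᵖ) (h : IsSelfInjective A) : IsSelfInjective B := by
  have : Module.Injective A A := h
  have h1 : Module.Injective A (OpDual (revIso τ) B) := OpDual.injective_of_projective
  have h2 : Module.Projective A (OpDual (revIso τ) B) := projective_of_finite_of_injective τ _
  have h3 : Module.Injective B (OpDual (revIso (revIso τ)) (OpDual (revIso τ) B)) :=
    OpDual.injective_of_projective
  exact Module.Injective.of_linearEquiv (OpDual.evalEquiv (revIso τ) B)

end Symmetry

/-! ### Projective and injective modules over a self-injective algebra -/

section QuasiFrobenius

/-- The case of a free module of Bass' theorem on sums of injective modules over a Noetherian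
ring. -/
lemma injective_finsupp {A : Type u} [Ring A] [IsNoetherianRing A] [Module.Injective A A]
    (X : Type u) : Module.Injective A (X →₀ A) := by
  classical
  refine Module.Baer.injective fun I f => ?_
  obtain ⟨t, ht⟩ := Module.Finite.fg_top (R := A) (M := I)
  let s : Finset X := t.biUnion fun a => (f a).support
  have hs : ∀ a, f a ∈ Finsupp.supported A A (s : Set X) := by
    have : (⊤ : Submodule A I) ≤ (Finsupp.supported A A (s : Set X)).comap f := by
      rw [← ht, Submodule.span_le]
      intro a ha x hx
      exact Finset.mem_coe.2 (Finset.mem_biUnion.2 ⟨a, ha, hx⟩)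
    exact fun a => this Submodule.mem_top
  have hc : ∀ x : X, ∃ c : A, ∀ a : I, f a x = a * c := by
    intro x
    obtain ⟨g, hg⟩ := Module.Injective.out (Q := A) I.subtype Subtype.val_injective
      (Finsupp.lapply x ∘ₗ f)
    refine ⟨g 1, fun a => ?_⟩
    have := hg a
    rw [LinearMap.comp_apply, Finsupp.lapply_apply] at this
    rw [← this, ← smul_eq_mul, ← map_smul, smul_eq_mul, mul_one]
    rfl
  choose c hc using hc
  refine ⟨LinearMap.toSpanSingleton A _ (Finsupp.indicator s fun x _ => c x), fun a ha => ?_⟩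
  ext x
  rw [LinearMap.toSpanSingleton_apply, Finsupp.smul_apply, Finsupp.indicator_apply]
  split_ifs with hx
  · rw [hc, smul_eq_mul]
  · rw [smul_zero]
    by_contra hne
    exact hx (hs ⟨a, ha⟩ (Finsupp.mem_support_iff.2 (Ne.symm hne)))

lemma injective_of_projective_of_isSelfInjective {A : Type u} [Ring A] [IsNoetherianRing A]
    (h : IsSelfInjective A) (P : Type u) [AddCommGroup P] [Module A P] [Module.Projective A P] :
    Module.Injective A P := by
  have : Module.Injective A A := h
  have := injective_finsupp (A := A) P
  obtain ⟨s, hs⟩ := Module.Projective.out (R := A) (P := P)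
  exact .of_split s _ hs

variable {k A B : Type u} [Field k] [Ring A] [Ring B] [Algebra k A] [Algebra k B]

/-- Every module `M` embeds into a direct sum of copies of the dual of the regular module of the
opposite algebra, by the coordinates of `a • m` in a basis of `M`. -/
lemma exists_injective_finsupp_opDual [FiniteDimensional k B] (τ : A ≃ₐ[k] Bᵐᵒᵖ) (M : Type u)
    [AddCommGroup M] [Module A M] :
    ∃ (X : Type u) (f : M →ₗ[A] X →₀ OpDual (revIso τ) B), Function.Injective f := by
  classical
  let := Module.compHom M (algebraMap k A)
  let β := Module.Basis.ofVectorSpace k M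
  let γ := Module.finBasis k B
  let ρ (m : M) : B →ₗ[k] M :=
    { toFun := fun b => antiIso τ b • m
      map_add' := by simp [add_smul]
      map_smul' := fun c b => by
        rw [Algebra.smul_def, Algebra.commutes, antiIso_mul, antiIso_algebraMap, mul_smul]; rfl }
  let φ (m : M) (x) : OpDual (revIso τ) B :=
    OpDual.mk _ (fun b => β.repr (ρ m b) x) (by simp) (fun c b => by
      rw [smul_eq_mul, ← Algebra.smul_def, map_smul, map_smul]; rfl)
  have hφ (m : M) (x) (b : B) : φ m x b = β.repr (antiIso τ b • m) x := rfl
  let F (m : M) : _ →₀ OpDual (revIso τ) B :=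
    Finsupp.onFinset (Finset.univ.biUnion fun i => (β.repr (ρ m (γ i))).support) (φ m) (by
      intro x hx
      by_contra hx'
      simp only [Finset.mem_biUnion, Finset.mem_univ, true_and, not_exists,
        Finsupp.mem_support_iff, not_not] at hx'
      apply hx
      have : β.coord x ∘ₗ ρ m = 0 := γ.ext fun i => by simpa using hx' i
      ext b
      exact DFunLike.congr_fun this b)
  have hF (m x) : F m x = φ m x := rfl
  refine ⟨_, { toFun := F, map_add' := fun m n => ?_, map_smul' := fun a m => ?_ }, ?_⟩
  · ext x b
    rw [Finsupp.add_apply, OpDual.add_apply, hF, hF, hF, hφ, hφ, hφ, smul_add, map_add,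
      Finsupp.add_apply]
  · ext x b
    rw [RingHom.id_apply, Finsupp.smul_apply, OpDual.smul_apply, hF, hF, hφ, hφ, smul_eq_mul,
      antiIso_mul, antiIso_antiIso_revIso, mul_smul]
  · refine (injective_iff_map_eq_zero _).2 fun m hm => ?_
    rw [← β.repr.map_eq_zero_iff]
    ext x
    have := DFunLike.congr_fun (DFunLike.congr_fun hm x) (1 : B)
    change β.repr (antiIso τ 1 • m) x = 0 at this
    simpa using this

lemma projective_of_injective_of_isSelfInjective [FiniteDimensional k A] [FiniteDimensional k B]
    (τ : A ≃ₐ[k] Bᵐᵒᵖ) (h : IsSelfInjective B) (M : Type u) [AddCommGroup M] [Module A M]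
    [Module.Injective A M] : Module.Projective A M := by
  classical
  have : Module.Injective B B := h
  have : Module.Projective A (OpDual (revIso τ) B) := OpDual.projective_of_injective
  obtain ⟨X, f, hf⟩ := exists_injective_finsupp_opDual τ M
  have : Module.Projective A (X →₀ OpDual (revIso τ) B) :=
    .of_equiv (finsuppLEquivDirectSum A _ X).symm
  obtain ⟨r, hr⟩ := Module.Injective.exists_retraction f hf
  exact Module.Projective.of_split f r (LinearMap.ext hr)

end QuasiFrobenius

/-! ### Resolutions and coresolutions by projective-injective modules -/

section Resolutions

/-- A finitely generated module that is both projective and injective. -/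
structure IsFiniteProjInj {A : Type u} [Ring A] (E : ModuleCat.{u} A) : Prop where
  finite : Module.Finite A E
  projective : Module.Projective A E
  injective : Module.Injective A E

/-- `Z` admits an infinite coresolution `0 → Z → E⁰ → E¹ → ⋯` by finitely generated
projective-injective modules. This is stated coinductively: `Z` belongs to a class of modules each
of which embeds into such a module with cokernel in the class. -/
def HasProjInjCoresolution {A : Type u} [Ring A] (Z : ModuleCat.{u} A) : Prop :=
  ∃ 𝒢 : ModuleCat.{u} A → Prop, 𝒢 Z ∧ ∀ Z, 𝒢 Z →
    ∃ (E C : ModuleCat.{u} A) (i : Z →ₗ[A] E) (p : E →ₗ[A] C), IsFiniteProjInj E ∧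
      Function.Injective i ∧ Function.Surjective p ∧ Function.Exact i p ∧ 𝒢 C

/-- `Z` admits an infinite resolution `⋯ → E₁ → E₀ → Z → 0` by finitely generated
projective-injective modules, again stated coinductively. -/
def HasProjInjResolution {A : Type u} [Ring A] (Z : ModuleCat.{u} A) : Prop :=
  ∃ 𝒢 : ModuleCat.{u} A → Prop, 𝒢 Z ∧ ∀ Z, 𝒢 Z →
    ∃ (E K : ModuleCat.{u} A) (i : K →ₗ[A] E) (p : E →ₗ[A] Z), IsFiniteProjInj E ∧
      Function.Injective i ∧ Function.Surjective p ∧ Function.Exact i p ∧ 𝒢 K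

section

variable {A : Type u} [Ring A]

lemma HasProjInjCoresolution.exists_step {Z : ModuleCat.{u} A} (h : HasProjInjCoresolution Z) :
    ∃ (E C : ModuleCat.{u} A) (i : Z →ₗ[A] E) (p : E →ₗ[A] C), IsFiniteProjInj E ∧
      Function.Injective i ∧ Function.Surjective p ∧ Function.Exact i p ∧
      HasProjInjCoresolution C := by
  obtain ⟨𝒢, hZ, h⟩ := h
  obtain ⟨E, C, i, p, hE, hi, hp, hex, hC⟩ := h Z hZ
  exact ⟨E, C, i, p, hE, hi, hp, hex, 𝒢, hC, h⟩

lemma HasProjInjResolution.exists_step {Z : ModuleCat.{u} A} (h : HasProjInjResolution Z) :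
    ∃ (E K : ModuleCat.{u} A) (i : K →ₗ[A] E) (p : E →ₗ[A] Z), IsFiniteProjInj E ∧
      Function.Injective i ∧ Function.Surjective p ∧ Function.Exact i p ∧
      HasProjInjResolution K := by
  obtain ⟨𝒢, hZ, h⟩ := h
  obtain ⟨E, K, i, p, hE, hi, hp, hex, hK⟩ := h Z hZ
  exact ⟨E, K, i, p, hE, hi, hp, hex, 𝒢, hK, h⟩

lemma HasProjInjCoresolution.of_linearEquiv {Z Z' : ModuleCat.{u} A}
    (h : HasProjInjCoresolution Z) (e : Z' ≃ₗ[A] Z) : HasProjInjCoresolution Z' := by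
  refine ⟨fun W => ∃ V : ModuleCat.{u} A, HasProjInjCoresolution V ∧ Nonempty (W ≃ₗ[A] V),
    ⟨Z, h, ⟨e⟩⟩, ?_⟩
  rintro W ⟨V, hV, ⟨e⟩⟩
  obtain ⟨E, C, i, p, hE, hi, hp, hex, hC⟩ := hV.exists_step
  refine ⟨E, C, i ∘ₗ e.toLinearMap, p, hE, hi.comp e.injective, hp, ?_, C, hC, ⟨.refl _ _⟩⟩
  intro x
  rw [hex x, LinearMap.coe_comp]
  simp only [LinearEquiv.coe_coe, EquivLike.range_comp]

/-- `p : Q → K` is a right approximation of `K` by finitely generated projective-injective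
modules: it is one itself, and every map from one to `K` lifts along `p`. -/
structure IsProjInjApproximation {Q K : ModuleCat.{u} A} (p : Q →ₗ[A] K) : Prop where
  source : IsFiniteProjInj Q
  exists_lift : ∀ (E : ModuleCat.{u} A), IsFiniteProjInj E → ∀ f : E →ₗ[A] K,
    ∃ g : E →ₗ[A] Q, p ∘ₗ g = f

lemma isFiniteProjInj_prod {E F : ModuleCat.{u} A} (hE : IsFiniteProjInj E)
    (hF : IsFiniteProjInj F) : IsFiniteProjInj (ModuleCat.of A (E × F)) := by
  obtain ⟨_, _, _⟩ := hE
  obtain ⟨_, _, _⟩ := hF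
  refine ⟨inferInstanceAs (Module.Finite A (E × F)),
    inferInstanceAs (Module.Projective A (E × F)), ⟨fun X Y _ _ _ _ i hi f => ?_⟩⟩
  obtain ⟨g, hg⟩ := Module.Injective.out (Q := E) i hi (LinearMap.fst A E F ∘ₗ f)
  obtain ⟨h, hh⟩ := Module.Injective.out (Q := F) i hi (LinearMap.snd A E F ∘ₗ f)
  exact ⟨g.prod h, fun x => Prod.ext (hg x) (hh x)⟩

/-- A Noetherian module has an approximation: a map from a projective-injective module with the
largest possible image. -/
lemma exists_isProjInjApproximation (K : ModuleCat.{u} A) [IsNoetherian A K] :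
    ∃ (Q : ModuleCat.{u} A) (p : Q →ₗ[A] K), IsProjInjApproximation p := by
  let 𝒮 : Set (Submodule A K) :=
    {N | ∃ (Q : ModuleCat.{u} A) (p : Q →ₗ[A] K), IsFiniteProjInj Q ∧ LinearMap.range p = N}
  have h0 : IsFiniteProjInj (ModuleCat.of A PUnit.{u + 1}) :=
    ⟨inferInstanceAs (Module.Finite A PUnit.{u + 1}),
      inferInstanceAs (Module.Projective A PUnit.{u + 1}),
      ⟨fun _ _ _ _ _ _ _ _ _ => ⟨0, fun _ => rfl⟩⟩⟩
  obtain ⟨_, ⟨Q, p, hQ, rfl⟩, hmax⟩ := set_has_maximal_iff_noetherian.2 ‹_› 𝒮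
    ⟨_, _, (0 : PUnit.{u + 1} →ₗ[A] K), h0, rfl⟩
  refine ⟨Q, p, hQ, fun E hE f => ?_⟩
  have hle : LinearMap.range f ≤ LinearMap.range p := by
    have := hmax _ ⟨_, p.coprod f, isFiniteProjInj_prod hQ hE, rfl⟩
    rw [LinearMap.range_coprod] at this
    by_contra hle
    exact this (left_lt_sup.2 hle)
  have := hE.projective
  obtain ⟨g, hg⟩ := Module.projective_lifting_property p.rangeRestrict
    (f.codRestrict _ fun x => hle ⟨x, rfl⟩) p.surjective_rangeRestrict
  exact ⟨g, LinearMap.ext fun x => congrArg Subtype.val (DFunLike.congr_fun hg x)⟩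

/-- Every map to `K` from a module with a coresolution by finitely generated projective-injective
modules lifts along every approximation of `K` by such modules. -/
def LiftsAlongApproximations (K : ModuleCat.{u} A) : Prop :=
  ∀ (Q : ModuleCat.{u} A) (p : Q →ₗ[A] K), IsProjInjApproximation p →
    ∀ (Z : ModuleCat.{u} A), HasProjInjCoresolution Z → ∀ f : Z →ₗ[A] K,
      ∃ g : Z →ₗ[A] Q, p ∘ₗ g = f

lemma liftsAlongApproximations_of_injective (K : ModuleCat.{u} A) [Module.Injective A K] :
    LiftsAlongApproximations K := by
  intro Q p hp Z hZ f
  obtain ⟨E, C, i, q, hE, hi, hq, hex, hC⟩ := hZ.exists_step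
  obtain ⟨f', hf'⟩ := Module.Injective.out (Q := K) i hi f
  obtain ⟨g, hg⟩ := hp.exists_lift E hE f'
  refine ⟨g ∘ₗ i, LinearMap.ext fun z => ?_⟩
  rw [← hf', ← hg]; rfl

/-- The lifting property passes to the kernel of an approximation. A map `Z → ker p` is extended
to `E → Q`, where `0 → Z → E → C → 0`; the failure of this extension to land in `ker p` is a map
`C → K`, which is lifted and subtracted. -/
lemma LiftsAlongApproximations.ker {Q K : ModuleCat.{u} A} {p : Q →ₗ[A] K}
    (hK : LiftsAlongApproximations K) (hp : IsProjInjApproximation p) :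
    LiftsAlongApproximations (ModuleCat.of A (LinearMap.ker p)) := by
  intro Q' p' hp' Z hZ f
  obtain ⟨E, C, i, q, hE, hi, hq, hex, hC⟩ := hZ.exists_step
  have := hp.source.injective
  obtain ⟨g, hg⟩ := Module.Injective.out (Q := Q) i hi ((LinearMap.ker p).subtype ∘ₗ f)
  have hle : LinearMap.ker q ≤ LinearMap.ker (p ∘ₗ g) := by
    intro x hx
    obtain ⟨z, rfl⟩ := (hex x).1 hx
    rw [LinearMap.mem_ker, LinearMap.comp_apply, hg]
    exact (f z).2
  let e := q.quotKerEquivOfSurjective hq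
  let h : C →ₗ[A] K := (LinearMap.ker q).liftQ (p ∘ₗ g) hle ∘ₗ e.symm.toLinearMap
  have hh (x : E) : h (q x) = p (g x) := by
    have : e.symm (q x) = Submodule.Quotient.mk x := by
      rw [LinearEquiv.symm_apply_eq]
      rfl
    change Submodule.liftQ _ _ hle (e.symm (q x)) = _
    rw [this, Submodule.liftQ_apply]; rfl
  obtain ⟨h', hh'⟩ := hK Q p hp C hC h
  have hker (x : E) : (g - h' ∘ₗ q) x ∈ LinearMap.ker p := by
    have := DFunLike.congr_fun hh' (q x)
    rw [LinearMap.comp_apply] at this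
    rw [LinearMap.mem_ker, LinearMap.sub_apply, map_sub, LinearMap.comp_apply, this, hh, sub_self]
  obtain ⟨g', hg'⟩ := hp'.exists_lift E hE ((g - h' ∘ₗ q).codRestrict _ hker)
  refine ⟨g' ∘ₗ i, LinearMap.ext fun z => Subtype.ext ?_⟩
  have := congrArg Subtype.val (DFunLike.congr_fun hg' (i z))
  change ((p' (g' (i z)) : LinearMap.ker p) : Q) = _
  refine this.trans ?_
  change g (i z) - h' (q (i z)) = _
  rw [hex.apply_apply_eq_zero, map_zero, sub_zero, hg]
  rfl

/-- If the regular module has a coresolution by finitely generated projective-injective modules,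
then every finitely generated injective module has a resolution by such modules: successive
approximations are surjective, because the lifting property applies to the regular module. -/
lemma HasProjInjCoresolution.hasProjInjResolution [IsNoetherianRing A]
    (hA : HasProjInjCoresolution (ModuleCat.of A A)) (I : ModuleCat.{u} A) [Module.Finite A I]
    [Module.Injective A I] : HasProjInjResolution I := by
  refine ⟨fun K => Module.Finite A K ∧ LiftsAlongApproximations K,
    ⟨inferInstance, liftsAlongApproximations_of_injective I⟩, ?_⟩
  rintro K ⟨_, hK⟩
  obtain ⟨Q, p, hp⟩ := exists_isProjInjApproximation K
  have := hp.source.finite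
  refine ⟨Q, ModuleCat.of A (LinearMap.ker p), (LinearMap.ker p).subtype, p, hp.source,
    Subtype.val_injective, fun x => ?_, LinearMap.exact_subtype_ker_map p,
    inferInstanceAs (Module.Finite A (LinearMap.ker p)), hK.ker hp⟩
  obtain ⟨g, hg⟩ := hK Q p hp _ hA (LinearMap.toSpanSingleton A K x)
  refine ⟨g (1 : A), ?_⟩
  have := DFunLike.congr_fun hg (1 : A)
  exact this.trans (by simp)

end

section Dual

variable {k A B : Type u} [Field k] [Ring A] [Ring B] [Algebra k A] [Algebra k B]
  [FiniteDimensional k A] [FiniteDimensional k B]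

lemma IsFiniteProjInj.opDual (τ : A ≃ₐ[k] Bᵐᵒᵖ) {E : ModuleCat.{u} A} (hE : IsFiniteProjInj E) :
    IsFiniteProjInj (ModuleCat.of B (OpDual τ E)) := by
  obtain ⟨_, _, _⟩ := hE
  exact ⟨inferInstanceAs (Module.Finite B (OpDual τ E)), OpDual.projective_of_injective,
    OpDual.injective_of_projective⟩

lemma HasProjInjResolution.opDual (τ : A ≃ₐ[k] Bᵐᵒᵖ) {Z : ModuleCat.{u} A}
    (h : HasProjInjResolution Z) : HasProjInjCoresolution (ModuleCat.of B (OpDual τ Z)) := by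
  refine ⟨fun W => ∃ V : ModuleCat.{u} A, HasProjInjResolution V ∧
    W = ModuleCat.of B (OpDual τ V), ⟨Z, h, rfl⟩, ?_⟩
  rintro _ ⟨V, hV, rfl⟩
  obtain ⟨E, K, i, p, hE, hi, hp, hex, hK⟩ := hV.exists_step
  exact ⟨ModuleCat.of B (OpDual τ E), ModuleCat.of B (OpDual τ K), OpDual.map τ p, OpDual.map τ i,
    hE.opDual τ, OpDual.map_injective hp, OpDual.map_surjective hi, OpDual.map_exact hp hex,
    K, hK, rfl⟩

lemma HasProjInjCoresolution.opDual (τ : A ≃ₐ[k] Bᵐᵒᵖ) {Z : ModuleCat.{u} A}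
    (h : HasProjInjCoresolution Z) : HasProjInjResolution (ModuleCat.of B (OpDual τ Z)) := by
  refine ⟨fun W => ∃ V : ModuleCat.{u} A, HasProjInjCoresolution V ∧
    W = ModuleCat.of B (OpDual τ V), ⟨Z, h, rfl⟩, ?_⟩
  rintro _ ⟨V, hV, rfl⟩
  obtain ⟨E, C, i, p, hE, hi, hp, hex, hC⟩ := hV.exists_step
  exact ⟨ModuleCat.of B (OpDual τ E), ModuleCat.of B (OpDual τ C), OpDual.map τ p, OpDual.map τ i,
    hE.opDual τ, OpDual.map_injective hp, OpDual.map_surjective hi, OpDual.map_exact hp hex,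
    C, hC, rfl⟩

/-- Infinite dominant dimension is left-right symmetric. -/
theorem HasProjInjCoresolution.opposite (τ : A ≃ₐ[k] Bᵐᵒᵖ)
    (h : HasProjInjCoresolution (ModuleCat.of A A)) :
    HasProjInjCoresolution (ModuleCat.of B B) := by
  have : IsNoetherianRing A := IsNoetherianRing.of_finite k A
  have : Module.Finite A (ModuleCat.of A (OpDual (revIso τ) B)) :=
    inferInstanceAs (Module.Finite A (OpDual (revIso τ) B))
  have : Module.Injective A (ModuleCat.of A (OpDual (revIso τ) B)) :=
    OpDual.injective_of_projective
  exact ((h.hasProjInjResolution (ModuleCat.of A (OpDual (revIso τ) B))).opDual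
    (revIso (revIso τ))).of_linearEquiv (OpDual.evalEquiv (revIso τ) B)

end Dual

section Minimal

/-- An essential extension of a finitely generated module over a finite-dimensional algebra is
finitely generated, because it embeds into every injective module containing the submodule. -/
lemma finite_of_isEssentialSubmodule {k A B : Type u} [Field k] [Ring A] [Ring B] [Algebra k A]
    [Algebra k B] [FiniteDimensional k A] [FiniteDimensional k B] (τ : A ≃ₐ[k] Bᵐᵒᵖ)
    {E : Type u} [AddCommGroup E] [Module A E] (N : Submodule A E) [Module.Finite A N]
    (hN : IsEssentialSubmodule N) : Module.Finite A E := by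
  have : IsNoetherianRing A := IsNoetherianRing.of_finite k A
  obtain ⟨J, i, _, _, hi⟩ := OpDual.exists_injective_embedding τ N
  obtain ⟨f, hf⟩ := Module.Injective.out (Q := J) N.subtype Subtype.val_injective i
  refine Module.Finite.of_injective f (LinearMap.ker_eq_bot.1 (hN _ ?_))
  rw [eq_bot_iff]
  rintro x ⟨hx, hx'⟩
  have h0 : i ⟨x, hx⟩ = 0 := (hf ⟨x, hx⟩).symm.trans hx'
  have := (injective_iff_map_eq_zero i).1 hi _ h0
  simpa using this

/-- In a minimal injective coresolution of the regular module all terms are finitely generated, so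
infinite dominant dimension yields a coresolution by finitely generated projective-injective
modules. -/
theorem HasInfiniteDominantDimension.hasProjInjCoresolution {k A B : Type u} [Field k] [Ring A]
    [Ring B] [Algebra k A] [Algebra k B] [FiniteDimensional k A] [FiniteDimensional k B]
    (τ : A ≃ₐ[k] Bᵐᵒᵖ) (h : HasInfiniteDominantDimension A) :
    HasProjInjCoresolution (ModuleCat.of A A) := by
  have : IsNoetherianRing A := IsNoetherianRing.of_finite k A
  obtain ⟨E, ⟨hmin0, hmin⟩, hproj⟩ := h
  let d (n : ℕ) := (E.cocomplex.d n (n + 1)).hom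
  have hinj (n : ℕ) : Module.Injective A (E.cocomplex.X n) := by
    have := E.injective n
    exact Module.injective_module_of_injective_object A (E.cocomplex.X n)
  have hex (n : ℕ) : LinearMap.range (d n) = LinearMap.ker (d (n + 1)) :=
    (E.exact_succ n).moduleCat_range_eq_ker
  have hex0 : LinearMap.range (E.ι.f 0).hom = LinearMap.ker (d 0) := E.exact₀.moduleCat_range_eq_ker
  have hmono : Function.Injective (E.ι.f 0).hom := by
    rw [← ModuleCat.mono_iff_injective]
    infer_instance
  refine ⟨fun Z => ∃ (n : ℕ) (N : Submodule A (E.cocomplex.X n)), Module.Finite A N ∧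
    IsEssentialSubmodule N ∧ N = LinearMap.ker (d n) ∧ Nonempty (Z ≃ₗ[A] N),
    ⟨0, _, ?_, hmin0, hex0, ⟨LinearEquiv.ofInjective _ hmono⟩⟩, ?_⟩
  · have : Module.Finite A (((CochainComplex.single₀ (ModuleCat.{u} A)).obj
        (ModuleCat.of A A)).X 0) := inferInstanceAs (Module.Finite A A)
    exact Module.Finite.range (E.ι.f 0).hom
  · rintro Z ⟨n, N, _, hN, hker, ⟨e⟩⟩
    have : Module.Finite A (E.cocomplex.X n) := finite_of_isEssentialSubmodule τ N hN
    refine ⟨E.cocomplex.X n, ModuleCat.of A (LinearMap.range (d n)), N.subtype ∘ₗ e.toLinearMap,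
      (d n).rangeRestrict, ⟨this, hproj n, hinj n⟩, Subtype.val_injective.comp e.injective,
      (d n).surjective_rangeRestrict, ?_, n + 1, LinearMap.range (d n), inferInstance, hmin n,
      hex n, ⟨.refl _ _⟩⟩
    rw [LinearMap.exact_iff, LinearMap.ker_rangeRestrict, LinearMap.range_comp,
      LinearEquiv.range, Submodule.map_top, Submodule.range_subtype, hker]

end Minimal

end Resolutions

/-! ### Totally acyclic complexes -/

section Complexes

open Limits

variable {A : Type u} [Ring A]

/-- The embedding of `ℕ` into `ℤ` that reads a cochain complex as a chain complex in nonpositive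
degrees. -/
def embeddingUpNatDownInt : (ComplexShape.up ℕ).Embedding (ComplexShape.down ℤ) :=
  ComplexShape.Embedding.mk' _ _ (fun n => -(n : ℤ)) (fun _ _ h => by simpa using h)
    (by intro i j; simp only [ComplexShape.up_Rel, ComplexShape.down_Rel]; omega)

/-- The embedding of `ℕ` into `ℤ` that reads a chain complex as one in nonnegative degrees. -/
def embeddingDownNatDownInt : (ComplexShape.down ℕ).Embedding (ComplexShape.down ℤ) :=
  ComplexShape.Embedding.mk' _ _ (fun n => (n : ℤ)) (fun _ _ h => by simpa using h)
    (by intro i j; simp only [ComplexShape.down_Rel]; omega)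

/-- An exact sequence `0 → X 0 → X 1 → ⋯` as an acyclic complex. -/
lemma exists_acyclic_of_exact_right (X : ℕ → ModuleCat.{u} A) (d : ∀ n, X n ⟶ X (n + 1))
    (hinj : Function.Injective (d 0).hom)
    (hex : ∀ n, Function.Exact (d n).hom (d (n + 1)).hom) :
    ∃ Y : ChainComplex (ModuleCat.{u} A) ℤ, Y.Acyclic ∧
      (∀ n, IsZero (Y.X n) ∨ ∃ m, Nonempty (Y.X n ≅ X m)) ∧ IsZero (Y.X 1) ∧
      ∃ (e₀ : Y.X 0 ≅ X 0) (e₁ : Y.X (-1) ≅ X 1), Y.d 0 (-1) = e₀.hom ≫ d 0 ≫ e₁.inv := by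
  have sq (n) : d n ≫ d (n + 1) = 0 := by
    ext x
    exact (hex n).apply_apply_eq_zero x
  let K := CochainComplex.of X d sq
  have hKd (n : ℕ) : K.d n (n + 1) = d n := CochainComplex.of_d X d n
  let e := embeddingUpNatDownInt
  have h₀ : e.f 0 = 0 := rfl
  have h₁ : e.f 1 = -1 := rfl
  have hK (n : ℕ) : K.ExactAt n := by
    cases n with
    | zero =>
      rw [K.exactAt_iff' 0 0 1 (by simp) (by simp), ShortComplex.exact_iff_mono]
      · change Mono (K.d 0 1)
        rw [hKd 0, ModuleCat.mono_iff_injective]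
        exact hinj
      · exact K.shape 0 0 (by simp)
    | succ n =>
      rw [K.exactAt_iff' n (n + 1) (n + 2) (by simp) (by simp),
        ShortComplex.moduleCat_exact_iff_range_eq_ker]
      change LinearMap.range (K.d n (n + 1)).hom = LinearMap.ker (K.d (n + 1) (n + 1 + 1)).hom
      rw [hKd, hKd]
      exact ((LinearMap.exact_iff).1 (hex n)).symm
  refine ⟨K.extend e, fun n => ?_, fun n => ?_, ?_, ?_⟩
  · by_cases h : ∃ m, e.f m = n
    · obtain ⟨m, rfl⟩ := h
      exact (K.extend_exactAt_iff e rfl).2 (hK m)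
    · exact K.extend_exactAt e n (by simpa using h)
  · by_cases h : ∃ m, e.f m = n
    · obtain ⟨m, hm⟩ := h
      exact Or.inr ⟨m, ⟨K.extendXIso e hm⟩⟩
    · exact Or.inl (K.isZero_extend_X e n (by simpa using h))
  · refine K.isZero_extend_X e 1 fun m (hm : -(m : ℤ) = 1) => ?_
    omega
  · refine ⟨K.extendXIso e h₀, K.extendXIso e h₁, ?_⟩
    rw [K.extend_d_eq e (i := 0) (j := 1) h₀ h₁]
    exact congrArg (fun f => _ ≫ f ≫ _) (hKd 0)

/-- An exact sequence `⋯ → X 1 → X 0 → 0` as an acyclic complex. -/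
lemma exists_acyclic_of_exact_left (X : ℕ → ModuleCat.{u} A) (d : ∀ n, X (n + 1) ⟶ X n)
    (hsurj : Function.Surjective (d 0).hom)
    (hex : ∀ n, Function.Exact (d (n + 1)).hom (d n).hom) :
    ∃ Y : ChainComplex (ModuleCat.{u} A) ℤ, Y.Acyclic ∧
      (∀ n, IsZero (Y.X n) ∨ ∃ m, Nonempty (Y.X n ≅ X m)) ∧ IsZero (Y.X (-1)) ∧
      ∃ (e₀ : Y.X 0 ≅ X 0) (e₁ : Y.X 1 ≅ X 1), Y.d 1 0 = e₁.hom ≫ d 0 ≫ e₀.inv := by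
  have sq (n) : d (n + 1) ≫ d n = 0 := by
    ext x
    exact (hex n).apply_apply_eq_zero x
  let K := ChainComplex.of X d sq
  have hKd (n : ℕ) : K.d (n + 1) n = d n := ChainComplex.of_d X d n
  let e := embeddingDownNatDownInt
  have h₀ : e.f 0 = 0 := rfl
  have h₁ : e.f 1 = 1 := rfl
  have hK (n : ℕ) : K.ExactAt n := by
    cases n with
    | zero =>
      rw [K.exactAt_iff' 1 0 0 (by simp) (by simp), ShortComplex.exact_iff_epi]
      · change Epi (K.d 1 0)
        rw [hKd 0, ModuleCat.epi_iff_surjective]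
        exact hsurj
      · exact K.shape 0 0 (by simp)
    | succ n =>
      rw [K.exactAt_iff' (n + 2) (n + 1) n (by simp) (by simp),
        ShortComplex.moduleCat_exact_iff_range_eq_ker]
      change LinearMap.range (K.d (n + 1 + 1) (n + 1)).hom = LinearMap.ker (K.d (n + 1) n).hom
      rw [hKd, hKd]
      exact ((LinearMap.exact_iff).1 (hex n)).symm
  refine ⟨K.extend e, fun n => ?_, fun n => ?_, ?_, ?_⟩
  · by_cases h : ∃ m, e.f m = n
    · obtain ⟨m, rfl⟩ := h
      exact (K.extend_exactAt_iff e rfl).2 (hK m)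
    · exact K.extend_exactAt e n (by simpa using h)
  · by_cases h : ∃ m, e.f m = n
    · obtain ⟨m, hm⟩ := h
      exact Or.inr ⟨m, ⟨K.extendXIso e hm⟩⟩
    · exact Or.inl (K.isZero_extend_X e n (by simpa using h))
  · refine K.isZero_extend_X e (-1) fun m (hm : (m : ℤ) = -1) => ?_
    omega
  · refine ⟨K.extendXIso e h₀, K.extendXIso e h₁, ?_⟩
    rw [K.extend_d_eq e (i := 1) (j := 0) h₁ h₀]
    exact congrArg (fun f => _ ≫ f ≫ _) (hKd 0)

lemma homFromComplex_exactAt_iff (Y : ChainComplex (ModuleCat.{u} A) ℤ) (M : ModuleCat.{u} A)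
    {i j l : ℤ} (hij : i + 1 = j) (hjl : j + 1 = l) :
    (homFromComplex Y M).ExactAt j ↔
      ∀ f : Y.X j ⟶ M, Y.d l j ≫ f = 0 → ∃ g : Y.X i ⟶ M, Y.d j i ≫ g = f := by
  rw [(homFromComplex Y M).exactAt_iff' i j l
    ((ComplexShape.down ℤ).symm.prev_eq' hij) ((ComplexShape.down ℤ).symm.next_eq' hjl),
    ShortComplex.ab_exact_iff]
  rfl

lemma homToComplex_exactAt_iff (M : ModuleCat.{u} A) (Y : ChainComplex (ModuleCat.{u} A) ℤ)
    {i j l : ℤ} (hij : i + 1 = j) (hjl : j + 1 = l) :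
    (homToComplex M Y).ExactAt j ↔
      ∀ f : M ⟶ Y.X j, f ≫ Y.d j i = 0 → ∃ g : M ⟶ Y.X l, g ≫ Y.d l j = f := by
  rw [(homToComplex M Y).exactAt_iff' l j i
    ((ComplexShape.down ℤ).prev_eq' hjl) ((ComplexShape.down ℤ).next_eq' hij),
    ShortComplex.ab_exact_iff]
  rfl

lemma acyclicProjectivesTotallyAcyclic_of_injective
    (h : ∀ M : ModuleCat.{u} A, Module.Projective A M → Module.Injective A M) :
    AcyclicProjectivesTotallyAcyclic A := by
  refine fun Y hY hac => ⟨hY, hac, fun M hM j => ?_⟩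
  rw [homFromComplex_exactAt_iff Y M (sub_add_cancel j 1) rfl]
  intro f hf
  have := h M hM
  have : Injective M := Module.injective_object_of_injective_module A M
  have hex := (Y.exactAt_iff' (j + 1) j (j - 1) (by simp) (by simp)).1 (hac j)
  exact ⟨hex.descToInjective f hf, hex.comp_descToInjective f hf⟩

lemma acyclicInjectivesTotallyAcyclic_of_projective
    (h : ∀ M : ModuleCat.{u} A, Module.Injective A M → Module.Projective A M) :
    AcyclicInjectivesTotallyAcyclic A := by
  refine fun Y hY hac => ⟨hY, hac, fun M hM j => ?_⟩
  rw [homToComplex_exactAt_iff M Y (sub_add_cancel j 1) rfl]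
  intro f hf
  have := h M hM
  have : Projective M := (IsProjective.iff_projective M).1 this
  have hex := (Y.exactAt_iff' (j + 1) j (j - 1) (by simp) (by simp)).1 (hac j)
  exact ⟨hex.liftFromProjective f hf, hex.liftFromProjective_comp f hf⟩

/-- The coresolution, spliced with zeros, is an acyclic complex of projectives; mapping it into its
first term shows that the coresolution splits. -/
lemma HasProjInjCoresolution.injective {M : ModuleCat.{u} A} (h : HasProjInjCoresolution M)
    [Module.Projective A M] (hA : AcyclicProjectivesTotallyAcyclic A) : Module.Injective A M := by
  choose E C i p hE hi hp hex hC using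
    fun Z : {Z : ModuleCat.{u} A // HasProjInjCoresolution Z} => Z.2.exists_step
  let Z (n : ℕ) : {Z : ModuleCat.{u} A // HasProjInjCoresolution Z} :=
    Nat.rec ⟨M, h⟩ (fun _ W => ⟨C W, hC W⟩) n
  let X : ℕ → ModuleCat.{u} A
    | 0 => M
    | n + 1 => E (Z n)
  let d : ∀ n, X n ⟶ X (n + 1)
    | 0 => ModuleCat.ofHom (i (Z 0))
    | n + 1 => ModuleCat.ofHom (i (Z (n + 1)) ∘ₗ p (Z n))
  have hd (n : ℕ) : Function.Exact (d n).hom (d (n + 1)).hom := by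
    have h1 (n : ℕ) : Function.Exact (i (Z n)) (d (n + 1)).hom := fun x => by
      rw [← hex (Z n) x]
      exact map_eq_zero_iff (i (Z (n + 1))) (hi (Z (n + 1)))
    cases n with
    | zero => exact h1 0
    | succ n =>
      intro x
      rw [h1 (n + 1) x]
      constructor
      · rintro ⟨y, rfl⟩
        obtain ⟨w, rfl⟩ := hp (Z n) y
        exact ⟨w, rfl⟩
      · rintro ⟨w, rfl⟩
        exact ⟨_, rfl⟩
  have hX : ∀ n, Module.Projective A (X n)
    | 0 => ‹_›
    | n + 1 => (hE (Z n)).projective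
  obtain ⟨Y, hac, hYX, hY1, e₀, e₁, he⟩ := exists_acyclic_of_exact_right X d (hi (Z 0)) hd
  have hY (n : ℤ) : Module.Projective A (Y.X n) := by
    rcases hYX n with h0 | ⟨m, ⟨e⟩⟩
    · have := ModuleCat.subsingleton_of_isZero h0
      infer_instance
    · have := hX m
      exact .of_equiv e.symm.toLinearEquiv
  obtain ⟨g, hg⟩ := (homFromComplex_exactAt_iff Y M (i := -1) (j := 0) (l := 1) rfl rfl).1
    ((hA Y hY hac).hom_acyclic M ‹_› 0) e₀.hom (hY1.eq_of_src _ _)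
  have hr : d 0 ≫ e₁.inv ≫ g = 𝟙 M := by
    rw [he] at hg
    refine (cancel_epi e₀.hom).1 (Eq.trans ?_ (Category.comp_id _).symm)
    simpa only [Category.assoc] using hg
  have := (hE (Z 0)).injective
  exact .of_split (J := E (Z 0)) (i (Z 0)) (e₁.inv ≫ g).hom
    fun x => DFunLike.congr_fun (congrArg ModuleCat.Hom.hom hr) x

/-- The resolution, spliced with zeros, is an acyclic complex of injectives; mapping its last
term into it shows that the resolution splits. -/
lemma HasProjInjResolution.projective {M : ModuleCat.{u} A} (h : HasProjInjResolution M)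
    [Module.Injective A M] (hA : AcyclicInjectivesTotallyAcyclic A) : Module.Projective A M := by
  choose E C i p hE hi hp hex hC using
    fun Z : {Z : ModuleCat.{u} A // HasProjInjResolution Z} => Z.2.exists_step
  let Z (n : ℕ) : {Z : ModuleCat.{u} A // HasProjInjResolution Z} :=
    Nat.rec ⟨M, h⟩ (fun _ W => ⟨C W, hC W⟩) n
  let X : ℕ → ModuleCat.{u} A
    | 0 => M
    | n + 1 => E (Z n)
  let d : ∀ n, X (n + 1) ⟶ X n
    | 0 => ModuleCat.ofHom (p (Z 0))
    | n + 1 => ModuleCat.ofHom (i (Z n) ∘ₗ p (Z (n + 1)))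
  have hd (n : ℕ) : Function.Exact (d (n + 1)).hom (d n).hom := by
    have h1 (n : ℕ) : Function.Exact (d (n + 1)).hom (p (Z n)) := fun x => by
      rw [hex (Z n) x]
      constructor
      · rintro ⟨y, rfl⟩
        obtain ⟨w, rfl⟩ := hp (Z (n + 1)) y
        exact ⟨w, rfl⟩
      · rintro ⟨w, rfl⟩
        exact ⟨_, rfl⟩
    cases n with
    | zero => exact h1 0
    | succ n =>
      intro x
      rw [← h1 (n + 1) x]
      exact map_eq_zero_iff (i (Z n)) (hi (Z n))
  have hX : ∀ n, Module.Injective A (X n)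
    | 0 => ‹_›
    | n + 1 => (hE (Z n)).injective
  obtain ⟨Y, hac, hYX, hY1, e₀, e₁, he⟩ := exists_acyclic_of_exact_left X d (hp (Z 0)) hd
  have hY (n : ℤ) : Module.Injective A (Y.X n) := by
    rcases hYX n with h0 | ⟨m, ⟨e⟩⟩
    · have := ModuleCat.subsingleton_of_isZero h0
      exact ⟨fun _ _ _ _ _ _ _ _ _ => ⟨0, fun _ => Subsingleton.elim _ _⟩⟩
    · have := hX m
      exact .of_linearEquiv e.toLinearEquiv
  obtain ⟨g, hg⟩ := (homToComplex_exactAt_iff M Y (i := -1) (j := 0) (l := 1) rfl rfl).1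
    ((hA Y hY hac).hom_acyclic M ‹_› 0) e₀.inv (hY1.eq_of_tgt _ _)
  have hr : (g ≫ e₁.hom) ≫ d 0 = 𝟙 M := by
    rw [he] at hg
    refine (cancel_mono e₀.inv).1 ?_
    simpa only [Category.assoc, Category.id_comp] using hg
  have := (hE (Z 0)).projective
  exact Module.Projective.of_split (P := M) (M := E (Z 0)) (g ≫ e₁.hom).hom (p (Z 0))
    (LinearMap.ext fun x => DFunLike.congr_fun (congrArg ModuleCat.Hom.hom hr) x)

end Complexes

/-! ### The equivalence -/

section Equivalence

variable {k A B : Type u} [Field k] [Ring A] [Ring B] [Algebra k A] [Algebra k B]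
  [FiniteDimensional k A] [FiniteDimensional k B]

lemma IsSelfInjective.acyclicProjectivesTotallyAcyclic [IsNoetherianRing A]
    (h : IsSelfInjective A) : AcyclicProjectivesTotallyAcyclic A :=
  acyclicProjectivesTotallyAcyclic_of_injective fun M _ =>
    injective_of_projective_of_isSelfInjective h M

lemma IsSelfInjective.acyclicInjectivesTotallyAcyclic (τ : A ≃ₐ[k] Bᵐᵒᵖ)
    (h : IsSelfInjective A) : AcyclicInjectivesTotallyAcyclic A :=
  acyclicInjectivesTotallyAcyclic_of_projective fun M _ =>
    projective_of_injective_of_isSelfInjective τ (h.opposite τ) M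

lemma isSelfInjective_of_acyclicProjectivesTotallyAcyclic
    (hA : HasProjInjCoresolution (ModuleCat.of A A)) (h : AcyclicProjectivesTotallyAcyclic A) :
    IsSelfInjective A :=
  have : Module.Projective A (ModuleCat.of A A) := inferInstanceAs (Module.Projective A A)
  hA.injective h

/-- The dual of a coresolution of `A` resolves the injective module `D A`, which is therefore
projective; its dual `A` is then injective. -/
lemma isSelfInjective_of_acyclicInjectivesTotallyAcyclic (τ : A ≃ₐ[k] Bᵐᵒᵖ)
    (hA : HasProjInjCoresolution (ModuleCat.of A A)) (h : AcyclicInjectivesTotallyAcyclic B) :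
    IsSelfInjective A := by
  have : Module.Injective B (ModuleCat.of B (OpDual τ A)) := OpDual.injective_of_projective
  have : Module.Projective B (OpDual τ A) := (hA.opDual τ).projective h
  have : Module.Injective A (OpDual (revIso τ) (OpDual τ A)) := OpDual.injective_of_projective
  exact Module.Injective.of_linearEquiv (OpDual.evalEquiv τ A)

theorem tfae_isSelfInjective (τ : A ≃ₐ[k] Bᵐᵒᵖ) (hA : HasInfiniteDominantDimension A) :
    List.TFAE [
      IsSelfInjective A,
      AcyclicInjectivesTotallyAcyclic A ∧ AcyclicInjectivesTotallyAcyclic B,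
      AcyclicProjectivesTotallyAcyclic A ∧ AcyclicProjectivesTotallyAcyclic B,
      AcyclicInjectivesTotallyAcyclic A,
      AcyclicProjectivesTotallyAcyclic A,
      AcyclicInjectivesTotallyAcyclic B,
      AcyclicProjectivesTotallyAcyclic B] := by
  have : IsNoetherianRing A := IsNoetherianRing.of_finite k A
  have : IsNoetherianRing B := IsNoetherianRing.of_finite k B
  have hA' := hA.hasProjInjCoresolution τ
  have hB' := hA'.opposite τ
  tfae_have 1 → 2 := fun h =>
    ⟨h.acyclicInjectivesTotallyAcyclic τ,
      (h.opposite τ).acyclicInjectivesTotallyAcyclic (revIso τ)⟩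
  tfae_have 1 → 3 := fun h =>
    ⟨h.acyclicProjectivesTotallyAcyclic, (h.opposite τ).acyclicProjectivesTotallyAcyclic⟩
  tfae_have 2 → 4 := And.left
  tfae_have 2 → 6 := And.right
  tfae_have 3 → 5 := And.left
  tfae_have 3 → 7 := And.right
  tfae_have 4 → 1 := fun h =>
    (isSelfInjective_of_acyclicInjectivesTotallyAcyclic (revIso τ) hB' h).opposite (revIso τ)
  tfae_have 5 → 1 := isSelfInjective_of_acyclicProjectivesTotallyAcyclic hA'
  tfae_have 6 → 1 := isSelfInjective_of_acyclicInjectivesTotallyAcyclic τ hA'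
  tfae_have 7 → 1 := fun h =>
    (isSelfInjective_of_acyclicProjectivesTotallyAcyclic hB' h).opposite (revIso τ)
  tfae_finish

end Equivalence

/-- A finite-dimensional algebra is finite-dimensional over a field in its own universe. This makes
the dual of a module live in the universe of the module. -/
lemma exists_field_finiteDimensional (k : Type*) [Field k] (R : Type u) [Ring R] [Algebra k R]
    [FiniteDimensional k R] :
    ∃ (K : Type u) (_ : Field K) (_ : Algebra K R), FiniteDimensional K R := by
  cases subsingleton_or_nontrivial R with
  | inl h =>
    let f : ULift.{u} ℚ →+* R :=
      { toFun := fun _ => 0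
        map_one' := Subsingleton.elim _ _
        map_mul' := fun _ _ => Subsingleton.elim _ _
        map_zero' := rfl
        map_add' := fun _ _ => Subsingleton.elim _ _ }
    let := f.toAlgebra' fun _ _ => Subsingleton.elim _ _
    exact ⟨ULift.{u} ℚ, inferInstance, this, inferInstance⟩
  | inr h =>
    have : Small.{u} k := small_of_injective (algebraMap k R).injective
    let e : Shrink.{u} k ≃+* k := Shrink.ringEquiv k
    let := ((algebraMap k R).comp e.toRingHom).toAlgebra' fun c x => Algebra.commutes (e c) x
    have hsmul (c : Shrink.{u} k) (x : R) : c • x = e c • x := by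
      rw [Algebra.smul_def, Algebra.smul_def]; rfl
    refine ⟨Shrink.{u} k, inferInstance, this, ?_⟩
    obtain ⟨s, hs⟩ := Module.Finite.fg_top (R := k) (M := R)
    refine ⟨⟨s, eq_top_iff.2 fun x _ => ?_⟩⟩
    have hx : x ∈ Submodule.span k (s : Set R) := hs ▸ Submodule.mem_top
    induction hx using Submodule.span_induction with
    | mem x h => exact Submodule.subset_span h
    | zero => exact Submodule.zero_mem _
    | add x y _ _ hx hy => exact Submodule.add_mem _ (hx trivial) (hy trivial)
    | smul c x _ hx =>
      rw [← e.apply_symm_apply c, ← hsmul]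
      exact Submodule.smul_mem _ _ (hx trivial)

theorem corollary2p10 {k : Type*} [Field k] {R : Type u} [Ring R] [Algebra k R]
    [FiniteDimensional k R] (hR : HasInfiniteDominantDimension R) :
    List.TFAE [
      IsSelfInjective R,
      AcyclicInjectivesTotallyAcyclic R ∧ AcyclicInjectivesTotallyAcyclic Rᵐᵒᵖ,
      AcyclicProjectivesTotallyAcyclic R ∧ AcyclicProjectivesTotallyAcyclic Rᵐᵒᵖ,
      AcyclicInjectivesTotallyAcyclic R,
      AcyclicProjectivesTotallyAcyclic R,
      AcyclicInjectivesTotallyAcyclic Rᵐᵒᵖ,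
      AcyclicProjectivesTotallyAcyclic Rᵐᵒᵖ] := by
  obtain ⟨K, _, _, _⟩ := exists_field_finiteDimensional k R
  exact tfae_isSelfInjective (AlgEquiv.opOp K R) hR
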